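/- For a metric space $X$, a set $A\subseteq X$ and $r>0$, let $N_r(A)$ be the smallest number of open sets of diameter at most $r$ required to cover $A$. The Assouad dimension of $F\subseteq\mathbb{R}^d$ is $$\dim_{\mathrm A}F=\inf\Big\{s\ge 0 : \exists\, C>0\ \ \forall R>0\ \ \forall r\in(0,R)\ \ \forall x\in F,\ \ N_r\big(B(x,R)\cap F\big)\le C\,(R/r)^s\Big\},$$ where $B(x,R)$ is the closed ball; $\dim_{\mathrm H}$ denotes Hausdorff dimension, $\mathcal K(\mathbb{R}^d)$ the collection of non-empty compact subsets of $\mathbb{R}^d$, and $G_{d,k}$ the set of $k$-dimensional linear subspaces of $\mathbb{R}^d$, each identified with the orthogonal projection of $\mathbb{R}^d$ onto it. **Theorem 2.11.** Let $1\le k<d$ be integers and let $F\subseteq\mathbb{R}^d$ be any set. Let $P\subseteq\mathbb{R}^n$ be a Borel set of positive $n$-dimensional Lebesgue measure and let $\{\pi_t\in G_{d,k} : t\in P\}$ be a family of projections such that $t\mapsto\pi_t$ is a bijection from $P$ onto this family (no further regularity is assumed). Then for Lebesgue almost every $t\in P$, $$\dim_{\mathrm A}\pi_tF\ \ge\ \inf_{\substack{E\in\mathcal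 K(\mathbb{R}^d):\\ \dim_{\mathrm H}E=\dim_{\mathrm A}F}}\ \operatorname*{ess\,inf}_{s\in P}\ \dim_{\mathrm A}\pi_sE .$$ Here the essential infimum of a function $f$ on $P$ is the supremum of all $c$ such that $f(s)\ge c$ for Lebesgue almost every $s\in P$. -/

import Mathlib

open MeasureTheory TopologicalSpace
open scoped ENNReal NNReal

/-- `N_r(A)`: the smallest number of open sets of diameter at most `r` needed to cover `A`
(`⊤` if no finite cover exists). -/
noncomputable def openCoverNumber {X : Type*} [PseudoMetricSpace X] (r : ℝ) (A : Set X) : ℕ∞ :=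
  ⨅ (U : Set (Set X)) (_ : (∀ u ∈ U, IsOpen u ∧ Metric.ediam u ≤ ENNReal.ofReal r) ∧ A ⊆ ⋃₀ U),
    U.encard

/-- `s` is an admissible exponent for the Assouad dimension of `F`: for some `C > 0`,
`N_r(B(x,R) ∩ F) ≤ C (R/r)^s` for all `0 < r < R` and all `x ∈ F`. -/
def IsAssouadExponent {X : Type*} [PseudoMetricSpace X] (F : Set X) (s : ℝ≥0) : Prop :=
  ∃ C : ℝ, 0 < C ∧ ∀ R : ℝ, 0 < R → ∀ r : ℝ, 0 < r → r < R → ∀ x ∈ F,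
    ((openCoverNumber r (Metric.closedBall x R ∩ F) : ℕ∞) : ℝ≥0∞) ≤
      ENNReal.ofReal (C * (R / r) ^ (s : ℝ))

/-- The Assouad dimension of `F`: the infimum of the admissible exponents `s ≥ 0`. -/
noncomputable def dimA {X : Type*} [PseudoMetricSpace X] (F : Set X) : ℝ≥0∞ :=
  ⨅ (s : ℝ≥0) (_ : IsAssouadExponent F s), (s : ℝ≥0∞)

/-- `G_{d,k}`: the `k`-dimensional linear subspaces of `ℝ^d`. Each is identified with the
orthogonal projection onto it, see `ProjectionSpace.proj`. -/
def ProjectionSpace (d k : ℕ) : Type :=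
  {V : Submodule ℝ (EuclideanSpace ℝ (Fin d)) // Module.finrank ℝ V = k}

/-- The orthogonal projection `ℝ^d → V ⊆ ℝ^d` of an element `V` of `G_{d,k}`. -/
noncomputable def ProjectionSpace.proj {d k : ℕ} (V : ProjectionSpace d k) :
    EuclideanSpace ℝ (Fin d) →L[ℝ] EuclideanSpace ℝ (Fin d) :=
  V.1.starProjection

open Filter Topology

/-! One compact set `E` serves all projections at once: a weak tangent of `F` with `dimH E = dimA
F`. It lies in arbitrarily small neighbourhoods of homothetic copies of `F`. Linear maps preserve
this relation and the Assouad dimension is monotone under it, so `dimA (πE) ≤ dimA (πF)` for every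
`π`. As `E` competes in the infimum, it remains only that an essential infimum is a lower bound
almost everywhere.

To build `E`, note that exponents below `dimA F` fail, so `F` has large separated subsets. By
`exists_uniform_ball`, some ball piece of such a subset is evenly spread over many dyadic scales.
These pieces, rescaled to the unit ball, subconverge in the Hausdorff metric, and counting their
points bounds `dimH` of the limit from below. -/

/-! ### Separated sets and evenly spread pieces. -/

theorem openCoverNumber_le_packingNumber {X : Type*} [PseudoMetricSpace X] {S : Set X} {r : ℝ≥0}
    (hr : 0 < r) : openCoverNumber (r : ℝ) S ≤ Metric.packingNumber (r / 4) S := by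
  by_cases h : Metric.packingNumber (r / 4) S = ⊤
  · simp [h]
  · have hcov := Metric.isCover_maximalSeparatedSet h
    rw [← Metric.encard_maximalSeparatedSet h]
    set N := Metric.maximalSeparatedSet (r / 4) S
    refine (iInf₂_le ((fun x => Metric.ball x ((r : ℝ) / 2)) '' N) ⟨?_, ?_⟩).trans
      (Set.encard_image_le _ _)
    · rintro _ ⟨x, -, rfl⟩
      refine ⟨Metric.isOpen_ball, ?_⟩
      rw [Metric.ediam_le_iff]
      · intro y hy z hz
        rw [edist_dist]
        apply ENNReal.ofReal_le_ofReal
        have h1 := Metric.mem_ball.1 hy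
        have h2 := Metric.mem_ball'.1 hz
        linarith [dist_triangle y x z]
    · intro x hx
      obtain ⟨y, hy, hxy⟩ := hcov hx
      refine ⟨_, ⟨y, hy, rfl⟩, ?_⟩
      have hxy' : edist x y ≤ ((r / 4 : ℝ≥0) : ℝ≥0∞) := hxy
      rw [edist_nndist, ENNReal.coe_le_coe] at hxy'
      have h3 : dist x y ≤ (r : ℝ) / 4 := by exact_mod_cast hxy'
      have : (0 : ℝ) < r := hr
      exact Metric.mem_ball.2 (by linarith)

theorem exists_finset_separated {X : Type*} [PseudoMetricSpace X] {S : Set X} {r : ℝ} (hr : 0 < r)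
    {c : ℝ} (h : ENNReal.ofReal c < (openCoverNumber r S : ℕ∞)) :
    ∃ A : Finset X, ↑A ⊆ S ∧ c ≤ A.card ∧ (A : Set X).Pairwise fun x y => r / 4 < dist x y := by
  lift r to ℝ≥0 using hr.le
  have hP : ENNReal.ofReal c < (Metric.packingNumber (r / 4) S : ℕ∞) :=
    h.trans_le (by exact_mod_cast openCoverNumber_le_packingNumber hr)
  obtain ⟨k, C, hck, hCS, hCsep, hkC⟩ : ∃ (k : ℕ) (C : Set X), c ≤ k ∧ C ⊆ S ∧
      Metric.IsSeparated ((r / 4 : ℝ≥0) : ℝ≥0∞) C ∧ (k : ℕ∞) ≤ C.encard := by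
    by_cases htop : Metric.packingNumber (r / 4) S = ⊤
    · have : ((⌈c⌉₊ : ℕ) : ℕ∞) < Metric.packingNumber (r / 4) S := by simp [htop]
      simp only [Metric.packingNumber, lt_iSup_iff] at this
      obtain ⟨C, hC, hC2, hlt⟩ := this
      exact ⟨⌈c⌉₊, C, Nat.le_ceil c, hC, hC2, hlt.le⟩
    · obtain ⟨C, hC, hfin, hC2, hC3⟩ := Metric.exists_set_encard_eq_packingNumber htop
      lift Metric.packingNumber (r / 4) S to ℕ using htop with p hp
      refine ⟨p, C, ?_, hC, hC2, hC3.ge⟩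
      by_contra! hlt
      refine hP.not_ge ?_
      simpa using ENNReal.ofReal_le_ofReal hlt.le
  obtain ⟨D, hDC, hD⟩ := Set.exists_subset_encard_eq hkC
  have hfin : D.Finite := Set.finite_of_encard_eq_coe hD
  refine ⟨hfin.toFinset, by simpa using hDC.trans hCS, ?_, ?_⟩
  · rw [hfin.encard_eq_coe_toFinset_card] at hD
    have : hfin.toFinset.card = k := by exact_mod_cast hD
    rwa [this]
  · simp only [Set.Finite.coe_toFinset]
    intro x hx y hy hxy
    have : ((r / 4 : ℝ≥0) : ℝ≥0∞) < edist x y := hCsep (hDC hx) (hDC hy) hxy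
    rw [edist_nndist, ENNReal.coe_lt_coe] at this
    exact_mod_cast this

theorem exists_forall_le_of_nat_bounded {X : Type*} [Nonempty X] (f : X → ℕ) (B : ℕ)
    (h : ∀ x, f x ≤ B) : ∃ y, ∀ z, f z ≤ f y := by
  obtain ⟨_, ⟨y, rfl⟩, hy⟩ := Set.exists_max_image (Set.range f) id
    ((Set.finite_Iic B).subset (by rintro _ ⟨x, rfl⟩; exact h x)) (Set.range_nonempty f)
  exact ⟨y, fun z => hy _ ⟨z, rfl⟩⟩

/-- A separated set with many points contains a ball-piece which is spread out evenly over the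
next `J` dyadic scales. -/
theorem exists_uniform_ball {X : Type*} [PseudoMetricSpace X] (A : Finset X) {r R s : ℝ}
    (hr : 0 < r) (hrR : r < R) (hs : 0 ≤ s) (J : ℕ)
    (hsep : (A : Set X).Pairwise fun x y => r / 4 < dist x y)
    (hcard : ((2 : ℝ) ^ (J + 4)) ^ s * (R / r) ^ s + 1 ≤ A.card)
    {x : X} (hx : ∀ y ∈ A, dist y x ≤ R) :
    ∃ ρ > 0, ∃ y, (A.filter fun w => dist w y ≤ ρ).Nonempty ∧ ∀ z, ∀ j ≤ J,
      ((A.filter fun w => dist w z ≤ ρ / 2 ^ j).card : ℝ) * ((2 : ℝ) ^ j) ^ s ≤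
        (A.filter fun w => dist w y ≤ ρ).card := by
  have : Nonempty X := ⟨x⟩
  have hR : 0 < R := hr.trans hrR
  set n : X → ℕ → ℕ := fun z i => (A.filter fun w => dist w z ≤ R / 2 ^ i).card with hn
  have hmax : ∀ i, ∃ y, ∀ z, n z i ≤ n y i := fun i =>
    exists_forall_le_of_nat_bounded (fun z => n z i) A.card fun z => Finset.card_filter_le _ _
  choose y hy using hmax
  -- At a scale maximising this weighted count, passing to any scale `j` steps finer divides the
  -- largest count by at least `2^(js)`.
  set h : ℕ → ℝ := fun i => n (y i) i * ((2 : ℝ) ^ i) ^ s with hh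
  -- Beyond level `I` balls have diameter at most `r/4` and hold at most one point of `A`. There `h`
  -- is too small to be maximal, so the maximiser is at most `I` and the next `J` scales stay in the
  -- range.
  obtain ⟨I₀, hI1, hI2⟩ := exists_nat_pow_near (x := 8 * (R / r)) (y := (2 : ℝ))
    (by have := (one_le_div hr).2 hrR.le; linarith) (by norm_num)
  set I := I₀ + 1 with hI
  have hIle : (2 : ℝ) ^ I ≤ 2 ^ 4 * (R / r) := by rw [hI, pow_succ]; linarith
  obtain ⟨i, hiM, hi⟩ := Finset.exists_max_image (Finset.range (I + J + 1)) h ⟨0, by simp⟩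
  have hh0 : (A.card : ℝ) ≤ h 0 := by
    have h1 : n x 0 = A.card := by
      simp only [hn]
      rw [Finset.filter_true_of_mem]
      simpa using hx
    have h2 := hy 0 x
    rw [h1] at h2
    simpa [hh] using h2
  have hh0i : h 0 ≤ h i := hi 0 (by simp)
  have hpos1 : 0 ≤ ((2 : ℝ) ^ (J + 4)) ^ s * (R / r) ^ s := by positivity
  have hiI : i ≤ I := by
    by_contra! hlt
    have hle1 : n (y i) i ≤ 1 := by
      rw [hn, Finset.card_le_one]
      intro a ha b hb
      by_contra hab
      rw [Finset.mem_filter] at ha hb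
      have h1 := hsep ha.1 hb.1 hab
      have h2 : R / 2 ^ i ≤ r / 8 := by
        have h3 : (2 : ℝ) ^ I ≤ 2 ^ i := pow_le_pow_right₀ (by norm_num) hlt.le
        have h4 : 8 * (R / r) ≤ 2 ^ i := hI2.le.trans h3
        rw [div_le_iff₀ (by positivity)]
        have : r / 8 * (8 * (R / r)) = R := by field_simp
        calc R = r / 8 * (8 * (R / r)) := this.symm
          _ ≤ _ := by gcongr
      linarith [dist_triangle_right a b (y i)]
    have h5 : h i ≤ ((2 : ℝ) ^ (J + 4)) ^ s * (R / r) ^ s := by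
      have h6 : (2 : ℝ) ^ i ≤ 2 ^ (J + 4) * (R / r) := by
        have : i ≤ I + J := by simpa [Nat.lt_succ_iff] using hiM
        calc (2 : ℝ) ^ i ≤ 2 ^ (I + J) := pow_le_pow_right₀ (by norm_num) this
          _ = 2 ^ I * 2 ^ J := pow_add _ _ _
          _ ≤ 2 ^ 4 * (R / r) * 2 ^ J := by gcongr
          _ = _ := by ring
      calc h i ≤ 1 * ((2 : ℝ) ^ i) ^ s := by
            simp only [hh]
            gcongr
            exact_mod_cast hle1
        _ ≤ (2 ^ (J + 4) * (R / r)) ^ s := by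
            rw [one_mul]
            exact Real.rpow_le_rpow (by positivity) h6 hs
        _ = _ := Real.mul_rpow (by positivity) (by positivity)
    linarith
  refine ⟨R / 2 ^ i, by positivity, y i, ?_, fun z j hj => ?_⟩
  · rw [← Finset.card_pos]
    by_contra! h0
    have h1 : n (y i) i = 0 := Nat.le_zero.1 h0
    have : h i = 0 := by simp [hh, h1]
    linarith
  · have h1 : h (i + j) ≤ h i := hi _ (by simp; omega)
    have h2 : (n z (i + j) : ℝ) ≤ n (y (i + j)) (i + j) := by exact_mod_cast hy (i + j) z
    have h3 : (n z (i + j) : ℝ) * ((2 : ℝ) ^ j) ^ s * ((2 : ℝ) ^ i) ^ s ≤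
        n (y i) i * ((2 : ℝ) ^ i) ^ s := by
      calc (n z (i + j) : ℝ) * ((2 : ℝ) ^ j) ^ s * ((2 : ℝ) ^ i) ^ s
          = n z (i + j) * ((2 : ℝ) ^ (i + j)) ^ s := by
            rw [pow_add, Real.mul_rpow (by positivity) (by positivity)]; ring
        _ ≤ n (y (i + j)) (i + j) * ((2 : ℝ) ^ (i + j)) ^ s := by gcongr
        _ ≤ _ := h1
    have h4 := le_of_mul_le_mul_right h3 (by positivity)
    have h5 : R / 2 ^ i / 2 ^ j = R / 2 ^ (i + j) := by rw [pow_add, div_div]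
    rw [h5]
    exact h4

/-! ### Approximation by homothetic copies. -/

section Scaling

variable {V : Type*} [NormedAddCommGroup V] [NormedSpace ℝ V]

/-- `E` is contained in arbitrarily small neighbourhoods of homothetic copies of `F`. -/
def IsApproxByScalings (E F : Set V) : Prop :=
  ∀ ε > 0, ∃ c : ℝ, 0 < c ∧ ∃ a : V, ∀ x ∈ E, ∃ y ∈ F, dist x (c • (y - a)) < ε

theorem dist_smul_sub_smul_sub {c : ℝ} (hc : 0 < c) (a x y : V) :
    dist (c • (x - a)) (c • (y - a)) = c * dist x y := by
  rw [dist_smul₀, dist_sub_right, Real.norm_of_nonneg hc.le]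

theorem exists_uniform_finset_of_not_isAssouadExponent {F : Set V} {s : ℝ≥0}
    (h : ¬ IsAssouadExponent F s) (J : ℕ) :
    ∃ A : Finset V, A.Nonempty ∧ (A : Set V) ⊆ Metric.closedBall 0 1 ∧
      (∃ c : ℝ, 0 < c ∧ ∃ a : V, ∀ x ∈ A, ∃ y ∈ F, x = c • (y - a)) ∧
      ∀ z, ∀ j ≤ J, ((A.filter fun w => dist w z ≤ 1 / 2 ^ j).card : ℝ) * ((2 : ℝ) ^ j) ^ (s : ℝ) ≤
        A.card := by
  classical
  simp only [IsAssouadExponent] at h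
  push Not at h
  obtain ⟨R, hR, r, hr, hrR, x, hx, hlt⟩ := h (((2 : ℝ) ^ (J + 4)) ^ (s : ℝ) + 1) (by positivity)
  obtain ⟨A, hA, hcard, hsep⟩ := exists_finset_separated hr hlt
  have h1 : 1 ≤ (R / r) ^ (s : ℝ) := Real.one_le_rpow ((one_le_div hr).2 hrR.le) s.coe_nonneg
  obtain ⟨ρ, hρ, y, hne, hy⟩ := exists_uniform_ball A hr hrR s.coe_nonneg J hsep
    (by linarith) (x := x) (fun y hy => (hA hy).1)
  set B := A.filter fun w => dist w y ≤ ρ with hB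
  have hρ' : 0 < ρ⁻¹ := inv_pos.2 hρ
  set φ : V → V := fun v => ρ⁻¹ • (v - y) with hφ
  have hinj : Function.Injective φ := fun v w hvw => by
    have := smul_right_injective V hρ'.ne' hvw
    exact sub_left_injective this
  refine ⟨B.image φ, hne.image _, ?_, ⟨ρ⁻¹, hρ', y, ?_⟩, fun z j hj => ?_⟩
  · intro w hw
    obtain ⟨v, hv, rfl⟩ := Finset.mem_image.1 (Finset.mem_coe.1 hw)
    have hv' := (Finset.mem_filter.1 hv).2
    have h2 : dist (φ v) (φ y) = ρ⁻¹ * dist v y := dist_smul_sub_smul_sub hρ' y v y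
    have h3 : φ y = 0 := by simp [hφ]
    rw [Metric.mem_closedBall, ← h3, h2, inv_mul_le_iff₀ hρ]
    simpa using hv'
  · intro w hw
    obtain ⟨v, hv, rfl⟩ := Finset.mem_image.1 hw
    exact ⟨v, (hA (Finset.mem_filter.1 hv).1).2, rfl⟩
  · rw [Finset.card_image_of_injective _ hinj, Finset.filter_image,
      Finset.card_image_of_injective _ hinj]
    refine le_trans ?_ (hy (y + ρ • z) j hj)
    -- Counts around `z` after rescaling are counts around its preimage `y + ρ • z` before.
    have hz : z = φ (y + ρ • z) := by simp [hφ, hρ.ne']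
    have hsub : (B.filter fun w => dist (φ w) z ≤ 1 / 2 ^ j) ⊆
        A.filter fun w => dist w (y + ρ • z) ≤ ρ / 2 ^ j := by
      intro w hw
      rw [Finset.mem_filter] at hw ⊢
      refine ⟨(Finset.mem_filter.1 hw.1).1, ?_⟩
      have h4 := hw.2
      rw [hz, dist_smul_sub_smul_sub hρ' y, inv_mul_le_iff₀ hρ] at h4
      simpa [div_eq_mul_inv] using h4
    have := Finset.card_le_card hsub
    gcongr

/-- A linear map carries the homothety with data `c`, `a` to the one with data `c`, `T a`, and
enlarges errors by at most `‖T‖`. -/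
theorem IsApproxByScalings.image {W : Type*} [NormedAddCommGroup W] [NormedSpace ℝ W] {E F : Set V}
    (h : IsApproxByScalings E F) (T : V →L[ℝ] W) : IsApproxByScalings (T '' E) (T '' F) := by
  intro ε hε
  obtain ⟨c, hc, a, hca⟩ := h (ε / (‖T‖ + 1)) (by positivity)
  refine ⟨c, hc, T a, ?_⟩
  rintro _ ⟨x, hx, rfl⟩
  obtain ⟨y, hy, hxy⟩ := hca x hx
  refine ⟨T y, ⟨y, hy, rfl⟩, ?_⟩
  have h1 : c • (T y - T a) = T (c • (y - a)) := by simp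
  rw [h1]
  rw [lt_div_iff₀ (by positivity)] at hxy
  calc dist (T x) (T (c • (y - a))) ≤ ‖T‖ * dist x (c • (y - a)) := T.dist_le_opNorm _ _
    _ ≤ dist x (c • (y - a)) * (‖T‖ + 1) := by nlinarith [dist_nonneg (x := x) (y := c • (y - a))]
    _ < ε := hxy

/-- The Assouad condition depends only on `R/r`, so it is blind to the factor `c`. A cover of a
piece of `F` is transported and thickened by `r/4`; diameters become at most `c · r/(2c) + 2 · r/4 =
r`. The ratio of scales grows to `4R/r`, whence `4^s`. -/
theorem IsAssouadExponent.of_isApproxByScalings {E F : Set V} {s : ℝ≥0}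
    (hF : IsAssouadExponent F s) (h : IsApproxByScalings E F) : IsAssouadExponent E s := by
  obtain ⟨C, hC, hF⟩ := hF
  refine ⟨C * 4 ^ (s : ℝ), by positivity, fun R hR r hr hrR x hx => ?_⟩
  obtain ⟨c, hc, a, hca⟩ := h (r / 4) (by positivity)
  obtain ⟨y, hy, hxy⟩ := hca x hx
  have key := hF (2 * R / c) (by positivity) (r / (2 * c)) (by positivity)
    (by rw [div_lt_div_iff₀ (by positivity) hc]; nlinarith [mul_pos hc hr, mul_pos hc hR]) y hy
  have heq : C * (2 * R / c / (r / (2 * c))) ^ (s : ℝ) = C * 4 ^ (s : ℝ) * (R / r) ^ (s : ℝ) := by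
    rw [mul_assoc, ← Real.mul_rpow (by norm_num) (by positivity)]
    congr 2
    field_simp
    norm_num
  rw [heq] at key
  refine le_trans ?_ key
  norm_cast
  refine le_iInf₂ fun U hU => ?_
  refine (iInf₂_le ((fun u => Metric.thickening (r / 4) ((fun v => c • (v - a)) '' u)) '' U)
    ⟨?_, ?_⟩).trans (Set.encard_image_le _ _)
  · rintro _ ⟨u, hu, rfl⟩
    refine ⟨Metric.isOpen_thickening, ?_⟩
    rw [Metric.ediam_le_iff]
    intro v hv w hw
    obtain ⟨_, ⟨v', hv', rfl⟩, hv2⟩ := Metric.mem_thickening_iff.1 hv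
    obtain ⟨_, ⟨w', hw', rfl⟩, hw2⟩ := Metric.mem_thickening_iff.1 hw
    have h1 := (Metric.edist_le_ediam_of_mem hv' hw').trans (hU.1 u hu).2
    rw [edist_dist, ENNReal.ofReal_le_ofReal_iff (by positivity)] at h1
    rw [edist_dist]
    apply ENNReal.ofReal_le_ofReal
    have h2 : c * dist v' w' ≤ r / 2 := by
      calc c * dist v' w' ≤ c * (r / (2 * c)) := by gcongr
        _ = r / 2 := by field_simp
    have h3 := dist_triangle4 v (c • (v' - a)) (c • (w' - a)) w
    rw [dist_smul_sub_smul_sub hc, dist_comm (c • (w' - a)) w] at h3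
    linarith
  · rintro e ⟨heR, heE⟩
    obtain ⟨f, hf, hef⟩ := hca e heE
    have hmem : f ∈ Metric.closedBall y (2 * R / c) ∩ F := by
      refine ⟨?_, hf⟩
      rw [Metric.mem_closedBall, le_div_iff₀ hc, mul_comm, ← dist_smul_sub_smul_sub hc a]
      have h3 := dist_triangle4 (c • (f - a)) e x (c • (y - a))
      rw [dist_comm _ e] at h3
      have := Metric.mem_closedBall.1 heR
      linarith
    obtain ⟨u, hu, hfu⟩ := hU.2 hmem
    exact ⟨_, ⟨u, hu, rfl⟩, Metric.mem_thickening_iff.2 ⟨_, ⟨f, hfu, rfl⟩, hef⟩⟩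

theorem IsApproxByScalings.dimA_le {E F : Set V} (h : IsApproxByScalings E F) :
    dimA E ≤ dimA F :=
  le_iInf₂ fun s hs => iInf₂_le s (hs.of_isApproxByScalings h)

end Scaling

theorem not_isAssouadExponent_of_lt_dimA {X : Type*} [PseudoMetricSpace X] {F : Set X} {s : ℝ≥0}
    (h : (s : ℝ≥0∞) < dimA F) : ¬ IsAssouadExponent F s :=
  fun hs => h.not_ge (iInf₂_le s hs)

theorem Set.Subsingleton.dimA_eq_zero {X : Type*} [PseudoMetricSpace X] {F : Set X}
    (h : F.Subsingleton) : dimA F = 0 := by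
  refine le_antisymm (iInf₂_le (0 : ℝ≥0) ⟨1, one_pos, fun R hR r hr hrR x hx => ?_⟩) bot_le
  have : openCoverNumber r (Metric.closedBall x R ∩ F) ≤ 1 := by
    refine (iInf₂_le {Metric.ball x (r / 2)} ⟨?_, ?_⟩).trans (by simp)
    · rintro _ rfl
      refine ⟨Metric.isOpen_ball, ?_⟩
      rw [Metric.ediam_le_iff]
      intro y hy z hz
      rw [edist_dist]
      apply ENNReal.ofReal_le_ofReal
      have h1 := Metric.mem_ball.1 hy
      have h2 := Metric.mem_ball'.1 hz
      linarith [dist_triangle y x z]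
    · rintro y ⟨-, hy⟩
      rw [h hy hx]
      simpa using hr
  simpa using (by exact_mod_cast this : ((openCoverNumber r (Metric.closedBall x R ∩ F) : ℕ∞) : ℝ≥0∞) ≤ 1)

/-! ### Bounds for Hausdorff dimension. -/

/-- Mass distribution principle for compact sets, in terms of finite open covers. -/
theorem IsCompact.le_dimH_of_forall_finite_cover {X : Type*} [MetricSpace X] {E : Set X}
    (hE : IsCompact E) {s c : ℝ≥0} (hs : 0 < s) (hc : 0 < c)
    (h : ∀ (I : Finset ℕ) (U : ℕ → Set X) (D : ℕ → ℝ≥0),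
      (∀ i ∈ I, Metric.ediam (U i) ≤ D i ∧ 0 < D i ∧ D i ≤ 1) → (∀ i, IsOpen (U i)) →
      E ⊆ ⋃ i ∈ I, U i → c ≤ ∑ i ∈ I, D i ^ (s : ℝ)) :
    (s : ℝ≥0∞) ≤ dimH E := by
  borelize X
  refine le_dimH_of_hausdorffMeasure_ne_zero (ne_of_gt ?_)
  have hc2 : (0 : ℝ≥0∞) < ((c / 2 : ℝ≥0) : ℝ≥0∞) := by
    rw [ENNReal.coe_pos]; positivity
  refine hc2.trans_le ?_
  rw [Measure.hausdorffMeasure_apply]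
  -- Mesh `1/2` leaves room to enlarge the covering sets while keeping diameters at most `1`.
  refine le_iSup₂_of_le ((1 / 2 : ℝ≥0) : ℝ≥0∞) (by rw [ENNReal.coe_pos]; positivity) ?_
  refine le_iInf fun t => le_iInf fun ht => le_iInf fun hd => ?_
  by_contra! hlt
  have hdtop : ∀ n, Metric.ediam (t n) ≠ ⊤ := fun n => ne_top_of_le_ne_top ENNReal.coe_ne_top (hd n)
  set d : ℕ → ℝ≥0 := fun n => (Metric.ediam (t n)).toNNReal
  have hdc : ∀ n, (d n : ℝ≥0∞) = Metric.ediam (t n) := fun n => ENNReal.coe_toNNReal (hdtop n)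
  have hd2 : ∀ n, d n ≤ 1 / 2 := fun n => by
    rw [← ENNReal.coe_le_coe, hdc]; exact hd n
  have hterm : ∀ n, ((d n ^ (s : ℝ) : ℝ≥0) : ℝ≥0∞) =
      ⨆ _ : (t n).Nonempty, Metric.ediam (t n) ^ (s : ℝ) := fun n => by
    rw [ENNReal.coe_rpow_of_nonneg _ s.coe_nonneg, hdc]
    rcases (t n).eq_empty_or_nonempty with h0 | h0
    · simp [h0, hs]
    · simp [h0]
  simp_rw [← hterm] at hlt
  obtain ⟨η, hη, hηsum⟩ := ENNReal.exists_pos_sum_of_countable hc2.ne' ℕ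
  -- The enlargement to open sets costs `η n` each, less than `c/2` in total; compactness then
  -- selects a finite subcover.
  have hδ : ∀ n, ∃ δ : ℝ≥0, 0 < δ ∧ δ ≤ 1 / 2 ∧ (d n + δ) ^ (s : ℝ) ≤ d n ^ (s : ℝ) + η n := by
    intro n
    have hcont : Continuous fun δ : ℝ≥0 => (d n + δ) ^ (s : ℝ) :=
      (NNReal.continuous_rpow_const s.coe_nonneg).comp (continuous_const.add continuous_id)
    have h1 : ∀ᶠ δ in 𝓝 (0 : ℝ≥0), (d n + δ) ^ (s : ℝ) < d n ^ (s : ℝ) + η n :=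
      hcont.continuousAt.eventually_lt_const (by simpa using hη n)
    have h2 : ∀ᶠ δ in 𝓝 (0 : ℝ≥0), δ < 1 / 2 := eventually_lt_nhds (by positivity)
    have h3 : ∀ᶠ δ in 𝓝[>] (0 : ℝ≥0), 0 < δ := eventually_mem_nhdsWithin
    obtain ⟨δ, ⟨h4, h5⟩, h6⟩ :=
      (((h1.and h2).filter_mono nhdsWithin_le_nhds).and h3).exists
    exact ⟨δ, h6, h5.le, h4.le⟩
  choose δ hδ0 hδ2 hδs using hδ
  have hcov : E ⊆ ⋃ n, Metric.thickening (δ n / 2 : ℝ≥0) (t n) := ht.trans <|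
    Set.iUnion_mono fun n => Metric.self_subset_thickening
      (by have := hδ0 n; positivity) _
  obtain ⟨I, hI⟩ := hE.elim_finite_subcover _ (fun n => Metric.isOpen_thickening) hcov
  have hfin := h I (fun n => Metric.thickening (δ n / 2 : ℝ≥0) (t n)) (fun n => d n + δ n)
    (fun n _ => ⟨?_, ?_, ?_⟩) (fun n => Metric.isOpen_thickening) hI
  · have : (c : ℝ≥0∞) < c := by
      calc (c : ℝ≥0∞) ≤ ((∑ i ∈ I, (d i + δ i) ^ (s : ℝ) : ℝ≥0) : ℝ≥0∞) := by exact_mod_cast hfin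
        _ ≤ ((∑ i ∈ I, (d i ^ (s : ℝ) + η i) : ℝ≥0) : ℝ≥0∞) := by
            rw [ENNReal.coe_le_coe]
            exact Finset.sum_le_sum fun i _ => hδs i
        _ = ∑ i ∈ I, ((d i ^ (s : ℝ) : ℝ≥0) : ℝ≥0∞) + ∑ i ∈ I, (η i : ℝ≥0∞) := by
            rw [Finset.sum_add_distrib]; push_cast; rfl
        _ ≤ (∑' i, ((d i ^ (s : ℝ) : ℝ≥0) : ℝ≥0∞)) + ∑' i, (η i : ℝ≥0∞) :=
            add_le_add (ENNReal.sum_le_tsum _) (ENNReal.sum_le_tsum _)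
        _ < ((c / 2 : ℝ≥0) : ℝ≥0∞) + ((c / 2 : ℝ≥0) : ℝ≥0∞) := ENNReal.add_lt_add hlt hηsum
        _ = c := by rw [← ENNReal.coe_add, add_halves]
    exact lt_irrefl _ this
  · refine (Metric.ediam_thickening_le _).trans (le_of_eq ?_)
    rw [← hdc]
    norm_cast
    congr 1
    field_simp
  · exact add_pos_of_nonneg_of_pos bot_le (hδ0 n)
  · calc d n + δ n ≤ 1 / 2 + 1 / 2 := add_le_add (hd2 n) (hδ2 n)
      _ = 1 := add_halves 1

/-- The Hausdorff dimension of a bounded set is at most its Assouad dimension. -/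
theorem dimH_le_dimA {X : Type*} [MetricSpace X] {E : Set X} (hE : Bornology.IsBounded E) :
    dimH E ≤ dimA E := by
  rcases E.eq_empty_or_nonempty with rfl | ⟨x, hx⟩
  · simp
  obtain ⟨R, hR, hER⟩ := hE.subset_closedBall_lt 0 x
  refine le_iInf₂ fun s hs => ?_
  obtain ⟨C, hC, h⟩ := hs
  borelize X
  refine dimH_le_of_hausdorffMeasure_ne_top
    (ne_top_of_le_ne_top (ENNReal.ofReal_ne_top (r := C * R ^ (s : ℝ))) ?_)
  have hcov : ∀ m : ℕ, ∃ U : Finset (Set X),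
      (∀ u ∈ U, Metric.ediam u ≤ ENNReal.ofReal (R / (m + 2))) ∧ E ⊆ ⋃ u : U, (u : Set X) ∧
      (U.card : ℝ≥0∞) ≤ ENNReal.ofReal (C * (m + 2) ^ (s : ℝ)) := by
    -- The scale `R/(m+2)` is strictly below `R`, and the `s`-sums of these covers stay below `C
    -- R^s`.
    intro m
    have h1 := h R hR (R / (m + 2)) (by positivity)
      (div_lt_self hR (by have : (0 : ℝ) ≤ m := by positivity
                          linarith)) x hx
    rw [Set.inter_eq_right.2 hER, div_div_cancel₀ hR.ne'] at h1
    have hne : openCoverNumber (R / (m + 2)) E ≠ ⊤ := by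
      intro htop
      simp [htop] at h1
    obtain ⟨U, hU⟩ := ENat.exists_eq_iInf (fun U : Set (Set X) => ⨅ (_ : (∀ u ∈ U, IsOpen u ∧
      Metric.ediam u ≤ ENNReal.ofReal (R / (m + 2))) ∧ E ⊆ ⋃₀ U), U.encard)
    have hU' : (⨅ (_ : (∀ u ∈ U, IsOpen u ∧
      Metric.ediam u ≤ ENNReal.ofReal (R / (m + 2))) ∧ E ⊆ ⋃₀ U), U.encard) =
        openCoverNumber (R / (m + 2)) E := hU
    by_cases hp : (∀ u ∈ U, IsOpen u ∧
      Metric.ediam u ≤ ENNReal.ofReal (R / (m + 2))) ∧ E ⊆ ⋃₀ U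
    · rw [iInf_pos hp] at hU'
      have hfin : U.Finite := Set.encard_ne_top_iff.1 (hU' ▸ hne)
      refine ⟨hfin.toFinset, fun u hu => (hp.1 u (hfin.mem_toFinset.1 hu)).2, ?_, ?_⟩
      · intro y hy
        obtain ⟨u, hu, hyu⟩ := hp.2 hy
        exact Set.mem_iUnion.2 ⟨⟨u, hfin.mem_toFinset.2 hu⟩, hyu⟩
      · rw [← hU', hfin.encard_eq_coe_toFinset_card] at h1
        simpa using h1
    · rw [iInf_neg hp] at hU'
      exact absurd hU'.symm hne
  choose U hUd hUc hUn using hcov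
  refine (Measure.hausdorffMeasure_le_liminf_sum (l := atTop) (s : ℝ) E
    (fun m : ℕ => ENNReal.ofReal (R / (m + 2))) ?_ (fun m (u : U m) => (u : Set X))
    (Eventually.of_forall fun m u => hUd m u u.2) (Eventually.of_forall hUc)).trans ?_
  · rw [← ENNReal.ofReal_zero]
    refine ENNReal.tendsto_ofReal ?_
    exact tendsto_const_nhds.div_atTop
      (tendsto_atTop_add_const_right _ _ tendsto_natCast_atTop_atTop)
  · refine liminf_le_of_le (by isBoundedDefault) fun b hb => ?_
    obtain ⟨m, hm⟩ := hb.exists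
    refine hm.trans ?_
    calc ∑ u : U m, Metric.ediam (u : Set X) ^ (s : ℝ)
        ≤ ∑ u : U m, ENNReal.ofReal (R / (m + 2)) ^ (s : ℝ) :=
          Finset.sum_le_sum fun u _ => ENNReal.rpow_le_rpow (hUd m u u.2) s.coe_nonneg
      _ = (U m).card * ENNReal.ofReal ((R / (m + 2)) ^ (s : ℝ)) := by
          rw [ENNReal.ofReal_rpow_of_nonneg (by positivity) s.coe_nonneg]
          simp
      _ ≤ ENNReal.ofReal (C * (m + 2) ^ (s : ℝ)) * ENNReal.ofReal ((R / (m + 2)) ^ (s : ℝ)) := by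
          gcongr
          exact hUn m
      _ = ENNReal.ofReal (C * R ^ (s : ℝ)) := by
          rw [← ENNReal.ofReal_mul (by positivity), mul_assoc,
            ← Real.mul_rpow (by positivity) (by positivity)]
          congr 3
          field_simp

/-! ### Weak tangents of full dimension. -/

section Tangent

variable {V : Type*} [NormedAddCommGroup V] [NormedSpace ℝ V] [ProperSpace V]

/-- The exponent `s - 1/(m+1)` is used over `m` scales only: since `2^(j/(m+1)) ≤ 2` for `j ≤ m`,
the deficit costs a factor `2`, and the limit `E` gets exponent `s` itself. No limit measure is
needed, as a finite open cover of `E` also covers the approximating finite sets far along the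
subsequence. -/
theorem exists_isApproxByScalings_le_dimH {F : Set V} {s : ℝ≥0} (hs : 0 < s)
    (h : ∀ s' < s, ¬ IsAssouadExponent F s') :
    ∃ E : NonemptyCompacts V, IsApproxByScalings (E : Set V) F ∧ (s : ℝ≥0∞) ≤ dimH (E : Set V) := by
  have key : ∀ m : ℕ, ∃ A : Finset V, A.Nonempty ∧ (A : Set V) ⊆ Metric.closedBall 0 1 ∧
      (∃ c : ℝ, 0 < c ∧ ∃ a : V, ∀ x ∈ A, ∃ y ∈ F, x = c • (y - a)) ∧
      ∀ z, ∀ j ≤ m, ((A.filter fun w => dist w z ≤ 1 / 2 ^ j).card : ℝ) ≤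
        2 * (1 / 2 ^ j) ^ (s : ℝ) * A.card := by
    intro m
    have hm : (0 : ℝ≥0) < 1 / (m + 1) := by positivity
    obtain ⟨A, h1, h2, h3, h4⟩ :=
      exists_uniform_finset_of_not_isAssouadExponent (h _ (tsub_lt_self hs hm)) m
    refine ⟨A, h1, h2, h3, fun z j hj => ?_⟩
    refine le_of_mul_le_mul_right ((h4 z j hj).trans ?_)
      (by positivity : (0 : ℝ) < (2 ^ j) ^ ((s - 1 / (m + 1) : ℝ≥0) : ℝ))
    have h5 : (s : ℝ) ≤ ((s - 1 / (m + 1) : ℝ≥0) : ℝ) + 1 / (m + 1) := by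
      have : s ≤ (s - 1 / (m + 1)) + 1 / (m + 1) := le_tsub_add
      exact_mod_cast this
    have h6 : ((2 : ℝ) ^ j) ^ (s : ℝ) ≤ 2 * (2 ^ j) ^ ((s - 1 / (m + 1) : ℝ≥0) : ℝ) := by
      calc ((2 : ℝ) ^ j) ^ (s : ℝ)
          ≤ (2 ^ j) ^ (((s - 1 / (m + 1) : ℝ≥0) : ℝ) + 1 / (m + 1)) :=
            Real.rpow_le_rpow_of_exponent_le (one_le_pow₀ (by norm_num)) h5
        _ = (2 ^ j) ^ ((s - 1 / (m + 1) : ℝ≥0) : ℝ) * (2 ^ j) ^ (1 / ((m : ℝ) + 1)) :=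
            Real.rpow_add (by positivity) _ _
        _ ≤ (2 ^ j) ^ ((s - 1 / (m + 1) : ℝ≥0) : ℝ) * 2 := by
            gcongr
            rw [← Real.rpow_natCast, ← Real.rpow_mul (by norm_num)]
            calc (2 : ℝ) ^ ((j : ℝ) * (1 / (m + 1))) ≤ 2 ^ (1 : ℝ) := by
                  refine Real.rpow_le_rpow_of_exponent_le (by norm_num) ?_
                  rw [mul_one_div, div_le_one (by positivity)]
                  have : (j : ℝ) ≤ m := by exact_mod_cast hj
                  linarith
              _ = 2 := Real.rpow_one 2
        _ = _ := mul_comm _ _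
    have h7 : (1 / 2 ^ j : ℝ) ^ (s : ℝ) * (2 ^ j) ^ (s : ℝ) = 1 := by
      rw [← Real.mul_rpow (by positivity) (by positivity)]
      simp
    calc (A.card : ℝ) = (1 / 2 ^ j : ℝ) ^ (s : ℝ) * (2 ^ j) ^ (s : ℝ) * A.card := by
          rw [h7, one_mul]
      _ ≤ (1 / 2 ^ j : ℝ) ^ (s : ℝ) * (2 * (2 ^ j) ^ ((s - 1 / (m + 1) : ℝ≥0) : ℝ)) * A.card := by
          gcongr
      _ = _ := by ring
  choose A hne hball happ hcard using key
  let K : ℕ → NonemptyCompacts V := fun m => ⟨⟨(A m : Set V), (A m).finite_toSet.isCompact⟩, hne m⟩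
  have hcomp : IsCompact {L : NonemptyCompacts V | (L : Set V) ⊆ Metric.closedBall 0 1} :=
    NonemptyCompacts.isCompact_subsets_of_isCompact (isCompact_closedBall _ _)
  obtain ⟨E, -, ψ, hψ, hlim⟩ := hcomp.tendsto_subseq (x := K) hball
  have hclose : ∀ ε > 0, ∀ᶠ m in atTop,
      Metric.hausdorffEDist (A (ψ m) : Set V) (E : Set V) < ENNReal.ofReal ε := fun ε hε =>
    EMetric.tendsto_nhds.1 hlim _ (ENNReal.ofReal_pos.2 hε)
  refine ⟨E, fun ε hε => ?_, ?_⟩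
  · obtain ⟨m, hm⟩ := (hclose ε hε).exists
    obtain ⟨c, hc, a, hca⟩ := happ (ψ m)
    refine ⟨c, hc, a, fun x hx => ?_⟩
    rw [Metric.hausdorffEDist_comm] at hm
    obtain ⟨w, hw, hxw⟩ := Metric.exists_edist_lt_of_hausdorffEDist_lt hx hm
    obtain ⟨y, hy, rfl⟩ := hca w hw
    exact ⟨y, hy, by rwa [edist_dist, ENNReal.ofReal_lt_ofReal_iff hε] at hxw⟩
  -- In `c`, the `2` comes from the uniformity bound and `2^s` from rounding diameters up to dyadic
  -- scales.
  · refine E.isCompact.le_dimH_of_forall_finite_cover (c := (2 * 2 ^ (s : ℝ))⁻¹) hs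
      (by positivity) fun I U D hD hopen hcov => ?_
    obtain ⟨ε, hε, hεU⟩ := E.isCompact.exists_thickening_subset_open
      (isOpen_biUnion fun i (_ : i ∈ I) => hopen i) hcov
    have hscale : ∀ i, ∃ j : ℕ, i ∈ I → (D i : ℝ) ≤ 1 / 2 ^ j ∧ (1 / 2 ^ j : ℝ) ≤ 2 * D i := by
      intro i
      by_cases hi : i ∈ I
      · obtain ⟨-, h0, h1⟩ := hD i hi
        have h0' : (0 : ℝ) < D i := h0
        obtain ⟨j, hj1, hj2⟩ := exists_nat_pow_near (x := (1 / D i : ℝ)) (y := (2 : ℝ))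
          ((one_le_div h0').2 (by exact_mod_cast h1)) (by norm_num)
        refine ⟨j, fun _ => ⟨?_, ?_⟩⟩
        · rw [le_div_iff₀ h0'] at hj1
          rw [le_div_iff₀ (by positivity)]
          linarith
        · rw [div_lt_iff₀ h0', pow_succ] at hj2
          rw [div_le_iff₀ (by positivity)]
          linarith
      · exact ⟨0, fun h => absurd h hi⟩
    choose j hj using hscale
    -- `m` is large enough for the finite set to lie inside the cover and for every dyadic level in
    -- use to be controlled.
    obtain ⟨m, hm, hmj⟩ := ((hclose ε hε).and (eventually_ge_atTop (I.sup j))).exists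
    classical
    have hsub : A (ψ m) ⊆ I.biUnion fun i => (A (ψ m)).filter (· ∈ U i) := by
      intro w hw
      obtain ⟨x, hx, hwx⟩ := Metric.exists_edist_lt_of_hausdorffEDist_lt (Finset.mem_coe.2 hw) hm
      rw [edist_dist, ENNReal.ofReal_lt_ofReal_iff hε] at hwx
      obtain ⟨i, hi, hwi⟩ := Set.mem_iUnion₂.1 (hεU (Metric.mem_thickening_iff.2 ⟨x, hx, hwx⟩))
      exact Finset.mem_biUnion.2 ⟨i, hi, Finset.mem_filter.2 ⟨hw, hwi⟩⟩
    have hpiece : ∀ i ∈ I, (((A (ψ m)).filter (· ∈ U i)).card : ℝ) ≤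
        2 * (2 * D i : ℝ) ^ (s : ℝ) * (A (ψ m)).card := by
      intro i hi
      rcases ((A (ψ m)).filter (· ∈ U i)).eq_empty_or_nonempty with h0 | ⟨z, hz⟩
      · rw [h0]
        simp only [Finset.card_empty, Nat.cast_zero]
        positivity
      · have hjm : j i ≤ ψ m := (Finset.le_sup hi).trans (hmj.trans (hψ.id_le m))
        calc (((A (ψ m)).filter (· ∈ U i)).card : ℝ)
            ≤ ((A (ψ m)).filter fun w => dist w z ≤ 1 / 2 ^ (j i)).card := by
              refine Nat.cast_le.2 (Finset.card_le_card fun w hw => ?_)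
              rw [Finset.mem_filter] at hw hz ⊢
              refine ⟨hw.1, le_trans ?_ (hj i hi).1⟩
              have := (Metric.edist_le_ediam_of_mem hw.2 hz.2).trans (hD i hi).1
              rw [edist_nndist, ENNReal.coe_le_coe] at this
              exact_mod_cast this
          _ ≤ 2 * (1 / 2 ^ (j i)) ^ (s : ℝ) * (A (ψ m)).card := hcard _ _ _ hjm
          _ ≤ _ := by
              have := (hj i hi).2
              gcongr
    have hApos : (0 : ℝ) < (A (ψ m)).card := by exact_mod_cast (hne (ψ m)).card_pos
    have htotal : ((A (ψ m)).card : ℝ) ≤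
        (∑ i ∈ I, 2 * (2 * D i : ℝ) ^ (s : ℝ)) * (A (ψ m)).card := by
      rw [Finset.sum_mul]
      calc ((A (ψ m)).card : ℝ) ≤ ∑ i ∈ I, (((A (ψ m)).filter (· ∈ U i)).card : ℝ) := by
            exact_mod_cast (Finset.card_le_card hsub).trans Finset.card_biUnion_le
        _ ≤ _ := Finset.sum_le_sum hpiece
    have hone : 1 ≤ ∑ i ∈ I, 2 * (2 * D i : ℝ) ^ (s : ℝ) :=
      le_of_mul_le_mul_right (by rwa [one_mul]) hApos
    have hfac : ∑ i ∈ I, 2 * (2 * D i : ℝ) ^ (s : ℝ) =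
        2 * 2 ^ (s : ℝ) * ∑ i ∈ I, (D i : ℝ) ^ (s : ℝ) := by
      rw [Finset.mul_sum]
      refine Finset.sum_congr rfl fun i _ => ?_
      rw [Real.mul_rpow (by norm_num) (D i).coe_nonneg, mul_assoc]
    rw [hfac] at hone
    rw [← NNReal.coe_le_coe]
    push_cast
    rw [inv_le_iff_one_le_mul₀' (by positivity)]
    exact hone

end Tangent

/-- Every set has a compact weak tangent whose Hausdorff dimension is its Assouad dimension. -/
theorem exists_isApproxByScalings_dimH_eq_dimA {V : Type*} [NormedAddCommGroup V] [NormedSpace ℝ V]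
    [FiniteDimensional ℝ V] {F : Set V} (hF : 0 < dimA F) :
    ∃ E : NonemptyCompacts V, IsApproxByScalings (E : Set V) F ∧ dimH (E : Set V) = dimA F := by
  have : ProperSpace V := FiniteDimensional.proper_real V
  have hub : ∀ E : NonemptyCompacts V, IsApproxByScalings (E : Set V) F →
      dimH (E : Set V) ≤ dimA F := fun E hE =>
    (dimH_le_dimA E.isCompact.isBounded).trans hE.dimA_le
  have htop : dimA F ≠ ⊤ := by
    -- If every exponent failed, a tangent would have dimension at least `dim V + 1`.
    intro htop
    obtain ⟨E, -, hE⟩ := exists_isApproxByScalings_le_dimH (F := F)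
      (s := (Module.finrank ℝ V : ℝ≥0) + 1) (by positivity)
      fun s' _ => not_isAssouadExponent_of_lt_dimA (by simp [htop])
    have h1 : dimH (E : Set V) ≤ Module.finrank ℝ V :=
      (dimH_mono (Set.subset_univ _)).trans_eq (Real.dimH_univ_eq_finrank V)
    have h2 := hE.trans h1
    norm_cast at h2
    omega
  lift dimA F to ℝ≥0 using htop with s hs
  obtain ⟨E, hE, hdim⟩ := exists_isApproxByScalings_le_dimH (F := F) (s := s) (by exact_mod_cast hF)
    fun s' hs' => not_isAssouadExponent_of_lt_dimA (by rw [← hs]; exact_mod_cast hs')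
  exact ⟨E, hE, le_antisymm (hub E hE) hdim⟩

theorem theorem2p11 (d k n : ℕ) (hk : 1 ≤ k) (hkd : k < d)
    (F : Set (EuclideanSpace ℝ (Fin d)))
    (P : Set (EuclideanSpace ℝ (Fin n))) (hP : MeasurableSet P) (hPpos : 0 < volume P)
    (π : EuclideanSpace ℝ (Fin n) → ProjectionSpace d k) (hπ : Set.InjOn π P) :
    ∀ᵐ t ∂(volume.restrict P),
      (⨅ (E : NonemptyCompacts (EuclideanSpace ℝ (Fin d)))
          (_ : dimH (E : Set (EuclideanSpace ℝ (Fin d))) = dimA F),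
        essInf (fun s => dimA ((π s).proj '' (E : Set (EuclideanSpace ℝ (Fin d)))))
          (volume.restrict P)) ≤
      dimA ((π t).proj '' F) := by
  obtain ⟨E, hE, hle⟩ : ∃ E : NonemptyCompacts (EuclideanSpace ℝ (Fin d)),
      dimH (E : Set (EuclideanSpace ℝ (Fin d))) = dimA F ∧
      ∀ V : ProjectionSpace d k, dimA (V.proj '' (E : Set (EuclideanSpace ℝ (Fin d)))) ≤
        dimA (V.proj '' F) := by
    -- The tangent construction requires a positive exponent; in dimension zero a single point
    -- serves.
    rcases eq_or_ne (dimA F) 0 with h0 | h0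
    · refine ⟨{0}, by simp [h0], fun V => ?_⟩
      rw [Set.Subsingleton.dimA_eq_zero]
      · exact bot_le
      · simp
    · obtain ⟨E, hE, hdim⟩ := exists_isApproxByScalings_dimH_eq_dimA (pos_iff_ne_zero.2 h0)
      exact ⟨E, hdim, fun V => (hE.image V.proj).dimA_le⟩
  filter_upwards [ae_essInf_le (μ := volume.restrict P)
    (f := fun s => dimA ((π s).proj '' (E : Set (EuclideanSpace ℝ (Fin d)))))] with t ht
  exact (iInf₂_le E hE).trans (ht.trans (hle (π t)))
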